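/- Let $R$ be a commutative Noetherian ring with identity and let $\mathfrak a$ be a proper ideal of $R$. For a finitely generated $R$-module $M$ and $i\ge 0$ let $\operatorname{H}^i_{\mathfrak a}(M)=\varinjlim_{n}\operatorname{Ext}^i_R(R/\mathfrak a^n,M)$ be the $i$-th local cohomology module, let $\operatorname{cd}(\mathfrak a,M)=\sup\{i\ge 0 : \operatorname{H}^i_{\mathfrak a}(M)\neq 0\}$ be the cohomological dimension of $M$ with respect to $\mathfrak a$, and, if $M\neq\mathfrak aM$, let $\operatorname{grade}(\mathfrak a,M)$ be the maximal length of an $M$-regular sequence contained in $\mathfrak a$. A finitely generated $R$-module $M$ is called $\mathfrak a$-relative Cohen–Macaulay if either $M=\mathfrak aM$, or $M\neq\mathfrak aM$ and $\operatorname{grade}(\mathfrak a,M)=\operatorname{cd}(\mathfrak a,M)$. Assume that there is a faithful $\mathfrak a$-relative Cohen–Macaulay $R$-module $M$ (in particular, $M$ is finitely generated) of finite projective dimension. Then $R$, as a module over itself, is $\mathfrak a$-relative Cohen–Macaulay. -/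

import Mathlib

universe u

namespace RelativeCM

open CategoryTheory

section

variable {R : Type u} [CommRing R] (a : Ideal R) (M : Type u) [AddCommGroup M] [Module R M]

open Classical in
/-- The grade of an ideal `a` on `M`: the largest length of an `M`-regular sequence of elements
of `a` when `a M ≠ M`, and `∞` when `a M = M`. (Over a Noetherian ring, for `M` finitely generated
with `a M ≠ M`, all maximal `M`-regular sequences in `a` have this length.) -/
noncomputable def idealGrade : ℕ∞ :=
  if a • (⊤ : Submodule R M) = ⊤ then ⊤
  else ⨆ rs ∈ {rs : List R | (∀ r ∈ rs, r ∈ a) ∧ RingTheory.Sequence.IsRegular M rs},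
    (rs.length : ℕ∞)

/-- The cohomological dimension of `M` with respect to `a`: the supremum of the integers `i` for
which the `i`-th local cohomology module of `M` with support in `a`, that is the direct limit of
the modules `Ext^i(R / a ^ n, M)`, is nonzero; it is `⊥` (that is `-∞`) if there is no such `i`,
and `⊤` if these `i` are unbounded. -/
noncomputable def cohomDim : WithBot ℕ∞ :=
  sSup {d : WithBot ℕ∞ | ∃ i : ℕ,
    Nontrivial ((localCohomology a i).obj (ModuleCat.of R M)) ∧ d = ((i : ℕ∞) : WithBot ℕ∞)}

/-- `M` is `a`-relative Cohen-Macaulay: it is finitely generated, and either `M = a M`, or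
`M ≠ a M` and the grade of `a` on `M` equals the cohomological dimension of `M` with respect
to `a`. -/
def IsRelativeCohenMacaulay : Prop :=
  Module.Finite R M ∧
    (a • (⊤ : Submodule R M) = ⊤ ∨
      (a • (⊤ : Submodule R M) ≠ ⊤ ∧ ((idealGrade a M : ℕ∞) : WithBot ℕ∞) = cohomDim a M))

end

end RelativeCM

/-! Let `rs` be a maximal `R`-regular sequence in `a`, of length `g`. Every element of `a` is a zero
divisor on `R ⧸ (rs)`, so `a` lies in a prime `p` associated to `R ⧸ (rs)`, and the local ring `R_p`
has depth `g`. Faithfulness makes `M_p` nonzero. It has finite projective dimension, so the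
inequality half of Auslander–Buchsbaum gives depth `M_p ≤ g`, hence grade `(a, M) ≤ g`
(`length_le_of_isWeaklyRegular`). As `M` is relative Cohen–Macaulay, `H^i_a(M) = 0` for all `i > g`.

This vanishing passes from `M` to every finite module (`ExtPowColimitVanishes.of_faithful`). Local
cohomology vanishes above the number of generators of `a`; descending from there, `H^i_a` is right
exact on finite modules once `H^(i+1)_a` is zero on them. A faithful `M` maps nontrivially to each
nonzero `R ⧸ I`, so Noetherian induction on `I` and prime filtrations apply. Thus cd `(a, R) ≤ g`,
while `H^g_a(R) ≠ 0` because a nonzero class of `Ext^g(R ⧸ a, R)` survives in the colimit.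

All cohomology is handled through `ExtPowColimitVanishes`: each class dies at a later stage of the
direct system. -/

/-! ### Comparison of the derived-functor `Ext` with `Abelian.Ext`. -/

section DerivedComparison

open CategoryTheory Limits Opposite

variable {R : Type u} [CommRing R] {X X' Y : ModuleCat.{u} R}

/-- The chain complex in `(ModuleCat R)ᵒᵖ` whose terms are the modules `Hom(Pₙ, Y)`. -/
noncomputable abbrev linearYonedaComplex (P : ProjectiveResolution X) (Y : ModuleCat.{u} R) :
    ChainComplex (ModuleCat.{u} R)ᵒᵖ ℕ :=
  (((linearYoneda R (ModuleCat.{u} R)).obj Y).rightOp.mapHomologicalComplex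
    (ComplexShape.down ℕ)).obj P.complex

/-- The cocycle `f : Pₙ ⟶ Y` represents the class `e` of the derived functor `Ext R`. -/
def RepresentsExt {n : ℕ} (P : ProjectiveResolution X) (f : P.complex.X n ⟶ Y)
    (e : ((Ext R (ModuleCat.{u} R) n).obj (op X)).obj Y) : Prop :=
  ∃ z : ((linearYonedaComplex P Y).opcycles n).unop,
    ((linearYonedaComplex P Y).pOpcycles n).unop z = f ∧
    e = (P.isoLeftDerivedObj ((linearYoneda R (ModuleCat.{u} R)).obj Y).rightOp n).hom.unop
      (((linearYonedaComplex P Y).homologyι n).unop z)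

lemma linearYonedaComplex_pOpcycles_unop_injective (P : ProjectiveResolution X) (n : ℕ) :
    Function.Injective ((linearYonedaComplex P Y).pOpcycles n).unop := by
  rw [← ModuleCat.mono_iff_injective]
  infer_instance

lemma exists_representsExt {n : ℕ} (P : ProjectiveResolution X)
    (e : ((Ext R (ModuleCat.{u} R) n).obj (op X)).obj Y) :
    ∃ f : P.complex.X n ⟶ Y, P.complex.d (n + 1) n ≫ f = 0 ∧ RepresentsExt P f e := by
  let I := P.isoLeftDerivedObj ((linearYoneda R (ModuleCat.{u} R)).obj Y).rightOp n
  have h1 : Function.Surjective I.hom.unop := by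
    rw [← ModuleCat.epi_iff_surjective]
    infer_instance
  have h2 : Function.Surjective ((linearYonedaComplex P Y).homologyι n).unop := by
    rw [← ModuleCat.epi_iff_surjective]
    infer_instance
  obtain ⟨y, hy⟩ := h1 e
  obtain ⟨z, rfl⟩ := h2 y
  refine ⟨((linearYonedaComplex P Y).pOpcycles n).unop z, ?_, z, rfl, hy.symm⟩
  have h := congrArg Quiver.Hom.unop ((linearYonedaComplex P Y).d_pOpcycles (n + 1) n)
  exact congrArg (fun t => t.hom z) h

lemma exists_of_cocycle {n : ℕ} (P : ProjectiveResolution X) (f : P.complex.X n ⟶ Y)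
    (hf : P.complex.d (n + 1) n ≫ f = 0) :
    ∃ e : ((Ext R (ModuleCat.{u} R) n).obj (op X)).obj Y, RepresentsExt P f e := by
  have hk := (linearYonedaComplex P Y).opcyclesIsCokernel (n + 1) n (by simp)
  let S : ShortComplex (ModuleCat.{u} R)ᵒᵖ :=
    ShortComplex.mk _ _ ((linearYonedaComplex P Y).d_pOpcycles (n + 1) n)
  have hS : S.Exact := S.exact_of_g_is_cokernel hk
  obtain ⟨z, hz⟩ := (ShortComplex.moduleCat_exact_iff _).1 hS.unop f hf
  exact ⟨_, z, hz, rfl⟩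

/-- Writing `next n` treats degree zero uniformly: `next 0 = 0` and the differential from `0` to `0`
vanishes, so the only coboundary there is `0`. -/
lemma RepresentsExt.eq_zero_iff {n : ℕ} {P : ProjectiveResolution X} {f : P.complex.X n ⟶ Y}
    {e : ((Ext R (ModuleCat.{u} R) n).obj (op X)).obj Y} (h : RepresentsExt P f e) :
    e = 0 ↔ ∃ g : P.complex.X ((ComplexShape.down ℕ).next n) ⟶ Y,
      P.complex.d n ((ComplexShape.down ℕ).next n) ≫ g = f := by
  obtain ⟨z, hz, rfl⟩ := h
  let I := P.isoLeftDerivedObj ((linearYoneda R (ModuleCat.{u} R)).obj Y).rightOp n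
  have h1 : Function.Injective I.hom.unop := by
    rw [← ModuleCat.mono_iff_injective]
    infer_instance
  have h2 : I.hom.unop (((linearYonedaComplex P Y).homologyι n).unop z) = 0 ↔
      ((linearYonedaComplex P Y).homologyι n).unop z = 0 := map_eq_zero_iff I.hom.unop.hom h1
  change I.hom.unop (((linearYonedaComplex P Y).homologyι n).unop z) = 0 ↔ _
  rw [h2]
  have hk := (linearYonedaComplex P Y).homologyIsKernel n _ rfl
  let S : ShortComplex (ModuleCat.{u} R)ᵒᵖ := ShortComplex.mk _ _
    ((linearYonedaComplex P Y).homologyι_comp_fromOpcycles n ((ComplexShape.down ℕ).next n))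
  have hS : S.Exact := S.exact_of_f_is_kernel hk
  have hcomp := congrArg Quiver.Hom.unop
    ((linearYonedaComplex P Y).p_fromOpcycles n ((ComplexShape.down ℕ).next n))
  have hinj := linearYonedaComplex_pOpcycles_unop_injective (Y := Y) P n
  constructor
  · intro h0
    obtain ⟨g, hg⟩ := (ShortComplex.moduleCat_exact_iff _).1 hS.unop z h0
    refine ⟨g, ?_⟩
    rw [← hz, ← hg]
    exact (congrArg (fun t => t.hom g) hcomp).symm
  · rintro ⟨g, hg⟩
    have : S.unop.f g = z := by
      apply hinj
      rw [hz, ← hg]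
      exact congrArg (fun t => t.hom g) hcomp
    rw [← this]
    exact congrArg (fun t => t.hom g) S.unop.zero

lemma RepresentsExt.map {n : ℕ} {P : ProjectiveResolution X} {P' : ProjectiveResolution X'}
    {f : P.complex.X n ⟶ Y} {e : ((Ext R (ModuleCat.{u} R) n).obj (op X)).obj Y}
    (h : RepresentsExt P f e) (g : X' ⟶ X) (φ : P'.complex ⟶ P.complex)
    (hφ : φ.f 0 ≫ P.π.f 0 = P'.π.f 0 ≫ g) :
    RepresentsExt P' (φ.f n ≫ f) (((Ext R (ModuleCat.{u} R) n).map g.op).app Y e) := by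
  obtain ⟨z, hz, rfl⟩ := h
  let F := ((linearYoneda R (ModuleCat.{u} R)).obj Y).rightOp
  let ψ : linearYonedaComplex P' Y ⟶ linearYonedaComplex P Y := (F.mapHomologicalComplex _).map φ
  refine ⟨(HomologicalComplex.opcyclesMap ψ n).unop z, ?_, ?_⟩
  · have := congrArg Quiver.Hom.unop (HomologicalComplex.p_opcyclesMap ψ n)
    refine (congrArg (fun t => t.hom z) this).trans ?_
    rw [← hz]
    rfl
  · have h1 := congrArg Quiver.Hom.unop
      (ProjectiveResolution.isoLeftDerivedObj_hom_naturality g P' P φ hφ F n)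
    have h2 := congrArg Quiver.Hom.unop (HomologicalComplex.homologyι_naturality ψ n)
    refine (congrArg (fun t => t.hom (((linearYonedaComplex P Y).homologyι n).unop z)) h1).trans ?_
    exact congrArg (fun t => (P'.isoLeftDerivedObj F n).hom.unop (t.hom z)) h2

lemma CategoryTheory.ProjectiveResolution.extMk_eq_zero_iff_next {n : ℕ} (P : ProjectiveResolution X)
    (f : P.complex.X n ⟶ Y) (hf : P.complex.d (n + 1) n ≫ f = 0) :
    P.extMk f (n + 1) rfl hf = 0 ↔ ∃ g : P.complex.X ((ComplexShape.down ℕ).next n) ⟶ Y,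
      P.complex.d n ((ComplexShape.down ℕ).next n) ≫ g = f := by
  cases n with
  | succ p => exact P.extMk_eq_zero_iff f _ rfl hf _ (by simp)
  | zero =>
    have h0 : P.complex.d 0 ((ComplexShape.down ℕ).next 0) = 0 := P.complex.shape _ _ (by simp)
    simp only [h0, zero_comp, exists_const_iff]
    refine ⟨fun h => ?_, fun h => ?_⟩
    · simp only [← P.extEquivCohomologyClass.apply_eq_iff_eq,
        ProjectiveResolution.extEquivCohomologyClass_extMk,
        ProjectiveResolution.extEquivCohomologyClass_zero,
        CochainComplex.HomComplex.CohomologyClass.mk_eq_zero_iff] at h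
      rw [CochainComplex.HomComplex.Cocycle.toSingleMk_mem_coboundaries_iff _ _ _ _ _ 1
        (by simp)] at h
      obtain ⟨g, hg⟩ := h
      rw [(CochainComplex.isZero_of_isStrictlyLE P.cochainComplex 0 1).eq_zero_of_src g,
        comp_zero] at hg
      refine ⟨⟨0⟩, ?_⟩
      rw [← cancel_epi (P.cochainComplexXIso (-0) 0 rfl).hom, comp_zero]
      exact hg
    · obtain ⟨-, rfl⟩ := h
      simp

/-- The two models of `Ext` have the same relation "pulls back to zero along `g`". -/
lemma exists_abelianExt_of_ext {n : ℕ} (e : ((Ext R (ModuleCat.{u} R) n).obj (op X)).obj Y) :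
    ∃ e' : Abelian.Ext.{u} X Y n, ∀ (X' : ModuleCat.{u} R) (g : X' ⟶ X),
      ((Ext R (ModuleCat.{u} R) n).map g.op).app Y e = 0 ↔
        (Abelian.Ext.mk₀ g).comp e' (zero_add n) = 0 := by
  let P := projectiveResolution X
  obtain ⟨f, hf, h⟩ := exists_representsExt P e
  refine ⟨P.extMk f (n + 1) rfl hf, fun X' g => ?_⟩
  let P' := projectiveResolution X'
  let φ : ProjectiveResolution.Hom P' P g :=
    { hom := ProjectiveResolution.lift g P' P
      hom_f_zero_comp_π_f_zero :=
        (ProjectiveResolution.lift_commutes_zero g P' P).trans (by simp) }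
  rw [ProjectiveResolution.mk₀_comp_extMk f (n + 1) rfl hf φ,
    ProjectiveResolution.extMk_eq_zero_iff_next]
  exact (h.map g φ.hom (ProjectiveResolution.lift_commutes_zero g P' P)).eq_zero_iff

/-- Vanishing of the colimit only depends on which classes die under pullback, so sharing a
representing cocycle suffices; no natural isomorphism is needed. -/
lemma exists_ext_of_abelianExt {n : ℕ} (e' : Abelian.Ext.{u} X Y n) :
    ∃ e : ((Ext R (ModuleCat.{u} R) n).obj (op X)).obj Y, ∀ (X' : ModuleCat.{u} R) (g : X' ⟶ X),
      ((Ext R (ModuleCat.{u} R) n).map g.op).app Y e = 0 ↔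
        (Abelian.Ext.mk₀ g).comp e' (zero_add n) = 0 := by
  let P := projectiveResolution X
  obtain ⟨f, hf, rfl⟩ := P.extMk_surjective e' (n + 1) rfl
  obtain ⟨e, h⟩ := exists_of_cocycle P f hf
  refine ⟨e, fun X' g => ?_⟩
  let P' := projectiveResolution X'
  let φ : ProjectiveResolution.Hom P' P g :=
    { hom := ProjectiveResolution.lift g P' P
      hom_f_zero_comp_π_f_zero :=
        (ProjectiveResolution.lift_commutes_zero g P' P).trans (by simp) }
  rw [ProjectiveResolution.mk₀_comp_extMk f (n + 1) rfl hf φ,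
    ProjectiveResolution.extMk_eq_zero_iff_next]
  exact (h.map g φ.hom (ProjectiveResolution.lift_commutes_zero g P' P)).eq_zero_iff

end DerivedComparison

/-! ### Vanishing of local cohomology in terms of the direct system. -/

section Vanishing

open CategoryTheory Limits Opposite

variable {R : Type u} [CommRing R]

/-- The projection `R ⧸ a ^ n ⟶ R ⧸ a ^ m` for `m ≤ n`. -/
noncomputable def powQuotientMap (a : Ideal R) {m n : ℕ} (h : m ≤ n) :
    ModuleCat.of R (R ⧸ a ^ n) ⟶ ModuleCat.of R (R ⧸ a ^ m) :=
  ModuleCat.ofHom (Submodule.mapQ _ _ LinearMap.id (Ideal.pow_le_pow_right h))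

/-- The direct system `Ext^i(R ⧸ a ^ m, N)` has zero colimit. -/
def ExtPowColimitVanishes (a : Ideal R) (i : ℕ) (N : ModuleCat.{u} R) : Prop :=
  ∀ (m : ℕ) (e : Abelian.Ext.{u} (ModuleCat.of R (R ⧸ a ^ m)) N i), ∃ (m' : ℕ) (h : m ≤ m'),
    (Abelian.Ext.mk₀ (powQuotientMap a h)).comp e (zero_add i) = 0

/-- Evaluation at `N` commutes with the colimit, and an element of a filtered colimit of modules is
zero exactly when it dies at a later stage. -/
lemma subsingleton_localCohomology_iff (a : Ideal R) (i : ℕ) (N : ModuleCat.{u} R) :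
    Subsingleton ((localCohomology a i).obj N) ↔ ExtPowColimitVanishes a i N := by
  let D := localCohomology.diagram (localCohomology.idealPowersDiagram a) i
  let F : ℕᵒᵖᵒᵖ ⥤ ModuleCat.{u} R := D ⋙ (evaluation _ _).obj N
  let I : (localCohomology a i).obj N ≅ colimit F := colimitObjIsoColimitCompEvaluation D N
  have : IsFiltered ℕᵒᵖᵒᵖ := IsFiltered.of_equivalence (opOpEquivalence ℕ).symm
  have : PreservesFilteredColimitsOfSize.{0, 0} (forget (ModuleCat.{u} R)) :=
    preservesSmallestFilteredColimits_of_preservesFilteredColimits _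
  have : PreservesColimit F (forget (ModuleCat.{u} R)) := inferInstance
  have hI := I.toLinearEquiv.toEquiv.subsingleton_congr
  rw [hI]
  constructor
  · intro hs m e'
    obtain ⟨e, he⟩ := exists_ext_of_abelianExt e'
    let x : F.obj (op (op m)) := e
    obtain ⟨j, f, hj⟩ := Concrete.colimit_rep_eq_zero R F (op (op m)) x (Subsingleton.elim _ _)
    refine ⟨j.unop.unop, f.unop.unop.down.down, ?_⟩
    exact (he _ _).1 hj
  · intro hv
    refine subsingleton_of_forall_eq 0 fun y => ?_
    obtain ⟨j, x, rfl⟩ := Concrete.colimit_exists_rep F y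
    obtain ⟨e', he⟩ := exists_abelianExt_of_ext (X := ModuleCat.of R (R ⧸ a ^ j.unop.unop)) x
    obtain ⟨m', h, hz⟩ := hv _ e'
    let f : j ⟶ op (op m') := (homOfLE h).op.op
    have hfx : F.map f x = 0 := (he _ _).2 hz
    rw [← colimit.w F f, ConcreteCategory.comp_apply, hfx, map_zero]

end Vanishing

/-! ### Exactness of local cohomology and reduction to cyclic modules. -/

section LongExactSequence

open CategoryTheory Limits

variable {R : Type u} [CommRing R] {a : Ideal R}

lemma powQuotientMap_comp (a : Ideal R) {m n k : ℕ} (h : m ≤ n) (h' : n ≤ k) :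
    powQuotientMap a h' ≫ powQuotientMap a h = powQuotientMap a (h.trans h') := by
  refine ModuleCat.hom_ext (LinearMap.ext fun x => ?_)
  obtain ⟨x, rfl⟩ := Submodule.Quotient.mk_surjective _ x
  rfl

namespace ExtPowColimitVanishes

variable {i : ℕ}

lemma of_isZero {N : ModuleCat.{u} R} (h : IsZero N) : ExtPowColimitVanishes a i N := by
  refine fun m e => ⟨m, le_rfl, ?_⟩
  have : e = 0 := by
    rw [← e.comp_mk₀_id, h.eq_of_src (𝟙 N) 0, Abelian.Ext.mk₀_zero, Abelian.Ext.comp_zero]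
  rw [this, Abelian.Ext.comp_zero]

lemma of_iso {N N' : ModuleCat.{u} R} (α : N ≅ N') (h : ExtPowColimitVanishes a i N) :
    ExtPowColimitVanishes a i N' := by
  intro m e
  obtain ⟨m', hm, h0⟩ := h m (e.comp (Abelian.Ext.mk₀ α.inv) (add_zero i))
  refine ⟨m', hm, ?_⟩
  have he : e = (e.comp (Abelian.Ext.mk₀ α.inv) (add_zero i)).comp
      (Abelian.Ext.mk₀ α.hom) (add_zero i) := by
    simp
  rw [he, ← Abelian.Ext.comp_assoc_of_third_deg_zero, h0, Abelian.Ext.zero_comp]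

variable {S : ShortComplex (ModuleCat.{u} R)}

lemma middle (hS : S.ShortExact) (h₁ : ExtPowColimitVanishes a i S.X₁)
    (h₃ : ExtPowColimitVanishes a i S.X₃) : ExtPowColimitVanishes a i S.X₂ := by
  intro m e
  obtain ⟨m', hm, h0⟩ := h₃ m (e.comp (Abelian.Ext.mk₀ S.g) (add_zero i))
  rw [← Abelian.Ext.comp_assoc_of_third_deg_zero] at h0
  obtain ⟨e₁, he₁⟩ := Abelian.Ext.covariant_sequence_exact₂ _ hS _ h0
  obtain ⟨m'', hm', h1⟩ := h₁ m' e₁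
  refine ⟨m'', hm.trans hm', ?_⟩
  rw [← powQuotientMap_comp a hm hm', ← Abelian.Ext.mk₀_comp_mk₀_assoc, ← he₁,
    ← Abelian.Ext.comp_assoc_of_third_deg_zero, h1, Abelian.Ext.zero_comp]

lemma right (hS : S.ShortExact) (h₂ : ExtPowColimitVanishes a i S.X₂)
    (h₁ : ExtPowColimitVanishes a (i + 1) S.X₁) : ExtPowColimitVanishes a i S.X₃ := by
  intro m e
  obtain ⟨m', hm, h0⟩ := h₁ m (e.comp hS.extClass rfl)
  have h0' : ((Abelian.Ext.mk₀ (powQuotientMap a hm)).comp e (zero_add i)).comp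
      hS.extClass rfl = 0 := by
    rw [← h0]
    exact Abelian.Ext.comp_assoc _ _ _ _ _ (by omega)
  obtain ⟨e₂, he₂⟩ := Abelian.Ext.covariant_sequence_exact₃ _ hS _ rfl h0'
  obtain ⟨m'', hm', h1⟩ := h₂ m' e₂
  refine ⟨m'', hm.trans hm', ?_⟩
  rw [← powQuotientMap_comp a hm hm', ← Abelian.Ext.mk₀_comp_mk₀_assoc, ← he₂,
    ← Abelian.Ext.comp_assoc_of_third_deg_zero, h1, Abelian.Ext.zero_comp]

/-- If the functor `H^i_a` is right exact on finite modules and kills a faithful finite module,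
then it kills all finite cyclic modules. -/
lemma quotient_of_faithful [IsNoetherianRing R] {M : Type u} [AddCommGroup M] [Module R M]
    [Module.Finite R M] [FaithfulSMul R M]
    (hM : ExtPowColimitVanishes a i (ModuleCat.of R M))
    (hsucc : ∀ (N : Type u) [AddCommGroup N] [Module R N] [Module.Finite R N],
      ExtPowColimitVanishes a (i + 1) (ModuleCat.of R N)) (I : Ideal R) :
    ExtPowColimitVanishes a i (ModuleCat.of R (R ⧸ I)) := by
  induction I using IsNoetherian.induction with
  | hgt I ih =>
    by_cases hI : I = ⊤
    · refine of_isZero ?_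
      rw [ModuleCat.isZero_iff_subsingleton]
      exact Submodule.Quotient.subsingleton_iff.2 hI
    have : Nontrivial (R ⧸ I) := Ideal.Quotient.nontrivial_iff.2 hI
    -- `Hom(M, R ⧸ I) = 0` would require an `R ⧸ I`-regular element in the annihilator of `M`, which
    -- is zero.
    have hne : ¬ Subsingleton (M →ₗ[R] R ⧸ I) := by
      rw [IsSMulRegular.subsingleton_linearMap_iff]
      rintro ⟨r, hr, hreg⟩
      rw [Module.annihilator_eq_bot.2 inferInstance, Submodule.mem_bot] at hr
      subst hr
      exact not_subsingleton (R ⧸ I) (IsSMulRegular.zero_iff_subsingleton.1 hreg)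
    have := not_subsingleton_iff_nontrivial.1 hne
    obtain ⟨f, hf⟩ := exists_ne (0 : M →ₗ[R] R ⧸ I)
    have h1 : ExtPowColimitVanishes a i (ModuleCat.of R (LinearMap.range f)) :=
      right (LinearMap.shortExact_shortComplexKer f.surjective_rangeRestrict) hM (hsucc _)
    let π : R →ₗ[R] (R ⧸ I) ⧸ LinearMap.range f := (LinearMap.range f).mkQ ∘ₗ Submodule.mkQ I
    have hπ : Function.Surjective π :=
      (Submodule.mkQ_surjective _).comp (Submodule.mkQ_surjective _)
    -- The cokernel of `f` is again cyclic, and by a strictly larger ideal since `f ≠ 0`; the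
    -- induction hypothesis covers it.
    have hlt : I < LinearMap.ker π := by
      refine lt_of_le_of_ne (fun r hr => ?_) fun heq => hf ?_
      · have : Submodule.mkQ I r = 0 := (Submodule.Quotient.mk_eq_zero I).2 hr
        simp [π, this]
      · ext m
        obtain ⟨r, hr⟩ := Submodule.mkQ_surjective I (f m)
        have hr' : r ∈ LinearMap.ker π := by
          rw [LinearMap.mem_ker, LinearMap.comp_apply, hr]
          simp
        rw [← heq] at hr'
        rw [← hr]
        exact (Submodule.Quotient.mk_eq_zero I).2 hr'
    have h3 := of_iso (LinearMap.quotKerEquivOfSurjective π hπ).toModuleIso (ih _ hlt)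
    let S := ModuleCat.shortComplexOfCompEqZero (LinearMap.range f).subtype
      (LinearMap.range f).mkQ (by ext x; simp)
    exact middle (S := S) (ModuleCat.shortComplex_shortExact S
      (LinearMap.exact_subtype_mkQ _) (Submodule.subtype_injective _)
      (Submodule.mkQ_surjective _)) h1 h3

/-- A finite module has a filtration with quotients `R ⧸ p`, and vanishing is stable under
extensions. -/
lemma of_quotient [IsNoetherianRing R]
    (h : ∀ I : Ideal R, ExtPowColimitVanishes a i (ModuleCat.of R (R ⧸ I)))
    (N : Type u) [AddCommGroup N] [Module R N] [hN : Module.Finite R N] :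
    ExtPowColimitVanishes a i (ModuleCat.of R N) := by
  induction hN using IsNoetherianRing.induction_on_isQuotientEquivQuotientPrime R with
  | subsingleton N => exact of_isZero (ModuleCat.isZero_iff_subsingleton.2 ‹_›)
  | quotient N p e => exact of_iso e.symm.toModuleIso (h p.1)
  | exact N₁ N₂ N₃ f g hf hg hfg h₁ h₃ =>
    let S := ModuleCat.shortComplexOfCompEqZero f g hfg.linearMap_comp_eq_zero
    exact middle (S := S) (ModuleCat.shortComplex_shortExact S hfg hf hg) h₁ h₃

end ExtPowColimitVanishes

end LongExactSequence

/-! ### Lifting power-torsion elements through injective modules. -/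

section TorsionLift

variable {R : Type*} [CommRing R]

/-- `y` is killed by a power of the ideal `a`. -/
def IsPowTorsion (a : Ideal R) {N : Type*} [AddCommGroup N] [Module R N] (y : N) : Prop :=
  ∃ m : ℕ, ∀ r ∈ a ^ m, r • y = 0

namespace IsPowTorsion

variable {a b : Ideal R} {N N' : Type*} [AddCommGroup N] [Module R N] [AddCommGroup N']
  [Module R N'] {y z : N}

lemma mono (h : b ≤ a) (hy : IsPowTorsion a y) : IsPowTorsion b y :=
  hy.imp fun m hm r hr => hm r (Ideal.pow_right_mono h m hr)

lemma map (f : N →ₗ[R] N') (hy : IsPowTorsion a y) : IsPowTorsion a (f y) :=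
  hy.imp fun m hm r hr => by rw [← map_smul, hm r hr, map_zero]

lemma of_map {f : N →ₗ[R] N'} (hf : Function.Injective f) (hy : IsPowTorsion a (f y)) :
    IsPowTorsion a y :=
  hy.imp fun m hm r hr => hf (by rw [map_smul, hm r hr, map_zero])

lemma smul (s : R) (hy : IsPowTorsion a y) : IsPowTorsion a (s • y) :=
  hy.imp fun m hm r hr => by rw [smul_comm, hm r hr, smul_zero]

lemma sub (hy : IsPowTorsion a y) (hz : IsPowTorsion a z) : IsPowTorsion a (y - z) := by
  obtain ⟨m, hm⟩ := hy
  obtain ⟨n, hn⟩ := hz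
  refine ⟨max m n, fun r hr => ?_⟩
  rw [smul_sub, hm r (Ideal.pow_le_pow_right (le_max_left _ _) hr),
    hn r (Ideal.pow_le_pow_right (le_max_right _ _) hr), sub_zero]

lemma sup_span_singleton (hy : IsPowTorsion b y) {x : R} {k : ℕ} (hx : x ^ k • y = 0) :
    IsPowTorsion (Ideal.span {x} ⊔ b) y := by
  obtain ⟨m, hm⟩ := hy
  refine ⟨k + m, fun r hr => ?_⟩
  obtain ⟨s, hs, t, ht, rfl⟩ := Submodule.mem_sup.1 (Ideal.sup_pow_add_le_pow_sup_pow hr)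
  rw [Ideal.span_singleton_pow, Ideal.mem_span_singleton'] at hs
  obtain ⟨c, rfl⟩ := hs
  rw [add_smul, mul_smul, hx, smul_zero, hm t ht, add_zero]

end IsPowTorsion

/-- Over a Noetherian ring the `b`-power-torsion of an injective module maps onto its localization
at any element `x`: up to a power of `x`, every `b`-torsion element is divisible by `x ^ k`. -/
lemma Module.Injective.exists_isPowTorsion_smul_eq {R : Type u} [CommRing R] [IsNoetherianRing R]
    {E : Type u} [AddCommGroup E] [Module R E] [Module.Injective R E] {b : Ideal R} {w : E}
    (hw : IsPowTorsion b w) (x : R) (k : ℕ) :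
    ∃ (l : ℕ) (w' : E), IsPowTorsion b w' ∧ x ^ (k + l) • w' = x ^ l • w := by
  obtain ⟨m, hm⟩ := hw
  let A := R ⧸ b ^ m
  let f : A →ₗ[R] A := LinearMap.lsmul R A x
  -- The kernels of powers of `x` on `R ⧸ b ^ m` stabilize from `l` on. Hence `x ^ (k + l) • y ↦ x ^
  -- l • φ y` is well defined, and it extends to all of `A` by injectivity of `E`; `w'` is the image
  -- of `1`.
  obtain ⟨l, hl⟩ := monotone_stabilizes_iff_noetherian.2 (inferInstance : IsNoetherian R A)
    f.iterateKer
  have hf (n : ℕ) (y : A) : (f ^ n) y = x ^ n • y := by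
    induction n with
    | zero => simp
    | succ n ih => rw [pow_succ', Module.End.mul_apply, ih, pow_succ', mul_smul]; rfl
  have hker {y : A} (hy : x ^ (k + l) • y = 0) : x ^ l • y = 0 := by
    have h1 : y ∈ LinearMap.ker (f ^ (k + l)) := by rw [LinearMap.mem_ker, hf, hy]
    have h2 : y ∈ LinearMap.ker (f ^ l) := by
      have := hl (k + l) (by omega)
      change y ∈ f.iterateKer l
      rw [this]
      exact h1
    rwa [LinearMap.mem_ker, hf] at h2
  let φ : A →ₗ[R] E := Submodule.liftQ _ (LinearMap.toSpanSingleton R E w) fun r hr => hm r hr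
  let μ : A →ₗ[R] A := LinearMap.lsmul R A (x ^ (k + l))
  have hle : LinearMap.ker μ ≤ LinearMap.ker (x ^ l • φ) := by
    intro y hy
    have := hker (y := y) hy
    rw [LinearMap.mem_ker, LinearMap.smul_apply, ← map_smul, this, map_zero]
  obtain ⟨h, hh⟩ := Module.Injective.out ((LinearMap.ker μ).liftQ μ le_rfl)
    (LinearMap.ker_eq_bot.1 (Submodule.ker_liftQ_eq_bot' _ _ rfl))
    ((LinearMap.ker μ).liftQ (x ^ l • φ) hle)
  let u : A := Submodule.Quotient.mk 1
  have hu : φ u = w := by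
    change (1 : R) • w = w
    rw [one_smul]
  refine ⟨l, h u, ⟨m, fun r hr => ?_⟩, ?_⟩
  · have : r • u = 0 := by
      rw [← Submodule.Quotient.mk_smul, Submodule.Quotient.mk_eq_zero]
      simpa using hr
    rw [← map_smul, this, map_zero]
  · have := hh (Submodule.Quotient.mk u)
    rw [Submodule.liftQ_apply, Submodule.liftQ_apply, LinearMap.smul_apply, hu] at this
    rw [← this, ← map_smul]
    rfl

/-- In an injective coresolution `0 → N j → E j → N (j + 1) → 0`, power-torsion elements for an
ideal with `n` generators lift from `N (j + 1)` to power-torsion elements of `E j` if `n ≤ j`. -/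
lemma exists_isPowTorsion_lift {R : Type u} [CommRing R] [IsNoetherianRing R]
    {N E : ℕ → Type u} [∀ j, AddCommGroup (N j)] [∀ j, Module R (N j)]
    [∀ j, AddCommGroup (E j)] [∀ j, Module R (E j)] [∀ j, Module.Injective R (E j)]
    (ι : ∀ j, N j →ₗ[R] E j) (p : ∀ j, E j →ₗ[R] N (j + 1))
    (hι : ∀ j, Function.Injective (ι j)) (hp : ∀ j, Function.Surjective (p j))
    (hex : ∀ j, Function.Exact (ι j) (p j)) (xs : List R) (j : ℕ) (hj : xs.length ≤ j)
    (y : N (j + 1)) (hy : IsPowTorsion (Ideal.ofList xs) y) :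
    ∃ z : E j, IsPowTorsion (Ideal.ofList xs) z ∧ p j z = y := by
  induction xs generalizing j with
  | nil =>
    obtain ⟨z, hz⟩ := hp j y
    refine ⟨z, ⟨1, fun r hr => ?_⟩, hz⟩
    have : r = 0 := by simpa using hr
    rw [this, zero_smul]
  | cons x xs ih =>
    obtain _ | j := j
    · simp at hj
    have hj' : xs.length ≤ j := by simpa using hj
    rw [Ideal.ofList_cons] at hy ⊢
    obtain ⟨z, hz, hzy⟩ := ih (j + 1) (by omega) y (hy.mono le_sup_right)
    obtain ⟨k, hk⟩ := hy
    have hxk : x ^ k • y = 0 :=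
      hk _ (Ideal.pow_mem_pow (Ideal.mem_sup_left (Ideal.mem_span_singleton_self x)) k)
    -- The lift `z` is torsion for `xs` only. The obstruction `x ^ k • z` comes from the cosyzygy,
    -- lifts one degree lower to `w`, and is divided by `x ^ k` up to `x ^ l`; subtracting the
    -- result makes `z` torsion for `x` too.
    obtain ⟨y', hy'⟩ := (hex (j + 1) (x ^ k • z)).1 (by rw [map_smul, hzy, hxk])
    obtain ⟨w, hw, hwy⟩ := ih j hj' y'
      (IsPowTorsion.of_map (hι (j + 1)) (hy' ▸ hz.smul (x ^ k)))
    obtain ⟨l, w', hw', hl⟩ := Module.Injective.exists_isPowTorsion_smul_eq hw x k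
    refine ⟨z - ι (j + 1) (p j w'), (hz.sub ((hw'.map (p j)).map (ι (j + 1)))).sup_span_singleton
      (k := k + l) ?_, ?_⟩
    · rw [smul_sub, ← map_smul, ← map_smul, hl, map_smul, map_smul, hwy, hy', ← mul_smul,
        ← pow_add, add_comm l k, sub_self]
    · rw [map_sub, (hex (j + 1)).apply_apply_eq_zero, sub_zero, hzy]

end TorsionLift

/-! ### Vanishing above the number of generators. -/

section ArithmeticRank

open CategoryTheory Limits

variable {R : Type u} [CommRing R]

/-- The `j`-th cosyzygy of `N` in the chosen injective coresolution. -/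
noncomputable def cosyzygy (N : ModuleCat.{u} R) : ℕ → ModuleCat.{u} R
  | 0 => N
  | j + 1 => cokernel (Injective.ι (cosyzygy N j))

/-- The short complex `0 → N j → E j → N (j + 1) → 0` of consecutive cosyzygies. -/
noncomputable def cosyzygyShortComplex (N : ModuleCat.{u} R) (j : ℕ) :
    ShortComplex (ModuleCat.{u} R) :=
  ShortComplex.mk (Injective.ι (cosyzygy N j)) (cokernel.π (Injective.ι (cosyzygy N j)))
    (cokernel.condition _)

lemma cosyzygyShortComplex_shortExact (N : ModuleCat.{u} R) (j : ℕ) :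
    (cosyzygyShortComplex N j).ShortExact where
  exact := ShortComplex.exact_cokernel _
  mono_f := inferInstanceAs (Mono (Injective.ι (cosyzygy N j)))
  epi_g := inferInstanceAs (Epi (cokernel.π (Injective.ι (cosyzygy N j))))

instance (N : ModuleCat.{u} R) (j : ℕ) : Injective (cosyzygyShortComplex N j).X₂ :=
  inferInstanceAs (Injective (Injective.under (cosyzygy N j)))

/-- A class in `Ext^(k + 1)` of the `j`-th cosyzygy is a coboundary as soon as the associated map
to the `(j + k + 1)`-st cosyzygy lifts along the injective module above it. -/
lemma exists_hom_cosyzygy (N : ModuleCat.{u} R) {L : ModuleCat.{u} R} (k j t : ℕ) (ht : j + k = t)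
    (e : Abelian.Ext.{u} L (cosyzygy N j) (k + 1)) :
    ∃ f : L ⟶ cosyzygy N (t + 1), ∀ (L' : ModuleCat.{u} R) (g : L' ⟶ L)
      (h : L' ⟶ (cosyzygyShortComplex N t).X₂), h ≫ (cosyzygyShortComplex N t).g = g ≫ f →
      (Abelian.Ext.mk₀ g).comp e (zero_add _) = 0 := by
  have hS := cosyzygyShortComplex_shortExact N
  induction k generalizing j with
  | zero =>
    obtain rfl : j = t := by omega
    obtain ⟨e', rfl⟩ := Abelian.Ext.covariant_sequence_exact₁ L (hS j) e
      (Abelian.Ext.eq_zero_of_injective _) rfl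
    obtain ⟨f, rfl⟩ := (Abelian.Ext.mk₀_bijective _ _).2 e'
    refine ⟨f, fun L' g h hgh => ?_⟩
    have h1 : (Abelian.Ext.mk₀ g).comp ((Abelian.Ext.mk₀ f).comp (hS j).extClass
        (zero_add 1)) (zero_add 1) = (Abelian.Ext.mk₀ h).comp
        ((Abelian.Ext.mk₀ (cosyzygyShortComplex N j).g).comp (hS j).extClass
        (zero_add 1)) (zero_add 1) := by
      rw [Abelian.Ext.mk₀_comp_mk₀_assoc, Abelian.Ext.mk₀_comp_mk₀_assoc, hgh]
      rfl
    refine h1.trans ?_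
    rw [ShortComplex.ShortExact.comp_extClass, Abelian.Ext.comp_zero]
    rfl
  | succ k ih =>
    obtain ⟨e', rfl⟩ := Abelian.Ext.covariant_sequence_exact₁ L (hS j) e
      (Abelian.Ext.eq_zero_of_injective _) rfl
    obtain ⟨f, hf⟩ := ih (j + 1) (by omega) e'
    refine ⟨f, fun L' g h hgh => ?_⟩
    have h1 := hf L' g h hgh
    have h2 := congrArg (fun t => t.comp (hS j).extClass rfl) h1
    refine Eq.trans ?_ (h2.trans (Abelian.Ext.zero_comp _ _ _ _ _))
    exact (Abelian.Ext.comp_assoc _ _ _ _ _ (by omega)).symm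

/-- Local cohomology with support in an ideal with `n` generators vanishes above degree `n`. -/
lemma extPowColimitVanishes_of_length_lt [IsNoetherianRing R] (xs : List R)
    (N : ModuleCat.{u} R) {i : ℕ} (hi : xs.length < i) :
    ExtPowColimitVanishes (Ideal.ofList xs) i N := by
  obtain ⟨k, rfl⟩ : ∃ k, i = k + 1 := ⟨i - 1, by omega⟩
  intro m e
  obtain ⟨f, hf⟩ := exists_hom_cosyzygy N k 0 k (by omega) e
  have hS := cosyzygyShortComplex_shortExact N
  have (j : ℕ) : Module.Injective R (cosyzygyShortComplex N j).X₂ :=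
    Module.injective_module_of_injective_object R _
      (inj := inferInstanceAs (Injective (cosyzygyShortComplex N j).X₂))
  -- `f 1` is killed by a power of the ideal; a lift `z` killed by the `m₁`-th power defines the
  -- required map from `R ⧸ a ^ max m m₁`.
  obtain ⟨z, ⟨m₁, hm₁⟩, hz⟩ := exists_isPowTorsion_lift (R := R)
    (N := fun j => (cosyzygy N j)) (E := fun j => (cosyzygyShortComplex N j).X₂)
    (fun j => (cosyzygyShortComplex N j).f.hom) (fun j => (cosyzygyShortComplex N j).g.hom)
    (fun j => (hS j).moduleCat_injective_f) (fun j => (hS j).moduleCat_surjective_g)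
    (fun j => (ShortComplex.ShortExact.moduleCat_exact_iff_function_exact _).1 (hS j).exact)
    xs k (by omega) (f (Submodule.Quotient.mk 1)) ⟨m, fun r hr => by
      rw [← map_smul, ← Submodule.Quotient.mk_smul, (Submodule.Quotient.mk_eq_zero _).2, map_zero]
      simpa using hr⟩
  refine ⟨max m m₁, le_max_left _ _, hf _ _ (ModuleCat.ofHom (Submodule.liftQ _
    (LinearMap.toSpanSingleton R _ z)
    fun r hr => hm₁ r (Ideal.pow_le_pow_right (le_max_right _ _) hr))) ?_⟩
  refine ModuleCat.hom_ext (LinearMap.ext fun x => ?_)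
  obtain ⟨r, rfl⟩ := Submodule.Quotient.mk_surjective _ x
  change (cosyzygyShortComplex N k).g.hom (r • z) = f.hom (Submodule.Quotient.mk r)
  have h1 : r • (Submodule.Quotient.mk 1 : R ⧸ Ideal.ofList xs ^ m) = Submodule.Quotient.mk r := by
    rw [← Submodule.Quotient.mk_smul, smul_eq_mul, mul_one]
  rw [← h1, map_smul, map_smul]
  exact congrArg (r • ·) hz

end ArithmeticRank

/-! ### Regular sequences, `Ext` and the bottom local cohomology. -/

section Grade

open CategoryTheory Limits RingTheory.Sequence Pointwise

variable {R : Type u} [CommRing R]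

lemma smul_top_quotSMulTop_ne_top {M : Type*} [AddCommGroup M] [Module R M] {I : Ideal R} {r : R}
    (hr : r ∈ I) (hI : I • (⊤ : Submodule R M) ≠ ⊤) :
    I • (⊤ : Submodule R (QuotSMulTop r M)) ≠ ⊤ := by
  intro eq
  absurd congrArg (Submodule.comap (Submodule.mkQ _)) eq
  simpa [Submodule.comap_smul_top_of_surjective I _ (Submodule.mkQ_surjective _),
    Submodule.smul_mono_left ((Ideal.span_singleton_le_iff_mem I).mpr hr),
    ← Submodule.ideal_span_singleton_smul] using hI

/-- Dimension shifting: multiplication by the first element `x` gives a connecting map from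
`Ext^n(L, M ⧸ xM)` to `Ext^(n+1)(L, M)`, injective because `Ext^n(L, M) = 0` below the length of the
sequence. -/
lemma nontrivial_ext_of_isRegular [IsNoetherianRing R] {I : Ideal R} {L : ModuleCat.{u} R}
    [Module.Finite R L] (hL : Module.support R L ⊆ PrimeSpectrum.zeroLocus I) (rs : List R)
    (M : Type u) [AddCommGroup M] [Module R M] [Module.Finite R M]
    (hM : I • (⊤ : Submodule R M) ≠ ⊤) (hrs : ∀ r ∈ rs, r ∈ I) (hreg : IsRegular M rs)
    (hHom : Nontrivial (L →ₗ[R] M ⧸ Ideal.ofList rs • (⊤ : Submodule R M))) :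
    Nontrivial (Abelian.Ext.{u} L (ModuleCat.of R M) rs.length) := by
  induction rs generalizing M with
  | nil =>
    let e : (M ⧸ Ideal.ofList ([] : List R) • (⊤ : Submodule R M)) ≃ₗ[R] M :=
      Submodule.quotEquivOfEqBot _ (by simp)
    have : Nontrivial (L →ₗ[R] M) :=
      (LinearEquiv.arrowCongr (LinearEquiv.refl R L) e).symm.toEquiv.nontrivial
    exact (Abelian.Ext.addEquiv₀.trans
      (ModuleCat.homAddEquiv (M := L) (N := ModuleCat.of R M))).toEquiv.nontrivial
  | cons x rs ih =>
    have hsub := ModuleCat.subsingleton_ext_of_exists_isRegular I L hL (ModuleCat.of R M)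
      hM.lt_top (x :: rs) hrs hreg rs.length (by simp)
    rw [isRegular_cons_iff] at hreg
    have hx := hrs x List.mem_cons_self
    have e := Submodule.quotOfListConsSMulTopEquivQuotSMulTopInner M x rs
    have h1 : Nontrivial (L →ₗ[R] QuotSMulTop x M ⧸
        Ideal.ofList rs • (⊤ : Submodule R (QuotSMulTop x M))) :=
      (LinearEquiv.arrowCongr (LinearEquiv.refl R L) e).symm.toEquiv.nontrivial
    have h2 := ih (QuotSMulTop x M) (smul_top_quotSMulTop_ne_top hx hM)
      (fun r hr => hrs r (List.mem_cons_of_mem _ hr)) hreg.2 h1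
    obtain ⟨y, hy⟩ := exists_ne
      (0 : Abelian.Ext.{u} L (ModuleCat.of R (QuotSMulTop x M)) rs.length)
    have hS := IsSMulRegular.smulShortComplex_shortExact (M := ModuleCat.of R M) hreg.1
    refine ⟨y.comp hS.extClass rfl, 0, fun h0 => hy ?_⟩
    obtain ⟨y', hy'⟩ := Abelian.Ext.covariant_sequence_exact₃ L hS y rfl h0
    rw [← hy', show y' = 0 from hsub.elim y' 0]
    exact Abelian.Ext.zero_comp ..

/-- A maximal regular sequence in a proper ideal `a`, together with a prime containing `a` which is
associated to the quotient by that sequence. -/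
lemma exists_maximal_isRegular [IsNoetherianRing R] {a : Ideal R} (ha : a ≠ ⊤) :
    ∃ rs : List R, (∀ r ∈ rs, r ∈ a) ∧ IsRegular R rs ∧
      ∃ p : Ideal R, p.IsPrime ∧ a ≤ p ∧ ∃ z : R, ∀ r, r ∈ p ↔ r * z ∈ Ideal.ofList rs := by
  have hreg {rs : List R} (h : ∀ r ∈ rs, r ∈ a) (hw : IsWeaklyRegular R rs) : IsRegular R rs := by
    refine ⟨hw, fun h0 => ha ?_⟩
    rw [smul_eq_mul, Ideal.mul_top] at h0
    exact top_le_iff.1 (h0.trans_le (Ideal.span_le.2 h))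
  have : Nontrivial R := by
    by_contra h
    rw [not_nontrivial_iff_subsingleton] at h
    exact ha (Subsingleton.elim _ _)
  -- Maximality is imposed on the generated ideal; appending a regular element strictly enlarges it.
  obtain ⟨J, ⟨rs, hrs, hw, rfl⟩, hmax⟩ := set_has_maximal_iff_noetherian.2
    (inferInstanceAs (IsNoetherian R R))
    {J : Ideal R | ∃ rs : List R, (∀ r ∈ rs, r ∈ a) ∧ IsWeaklyRegular R rs ∧ J = Ideal.ofList rs}
    ⟨⊥, [], by simp, by simp, by simp⟩
  refine ⟨rs, hrs, hreg hrs hw, ?_⟩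
  have hne : Ideal.ofList rs ≠ ⊤ := fun h =>
    ha (top_le_iff.1 (h.symm.trans_le (Ideal.span_le.2 hrs)))
  have hno (y : R) (hy : y ∈ a) : ¬ IsSMulRegular (R ⧸ Ideal.ofList rs) y := by
    intro hyreg
    refine hmax (Ideal.ofList (rs ++ [y])) ⟨rs ++ [y], ?_, ?_, rfl⟩ (lt_of_le_of_ne ?_ ?_)
    · intro r hr
      obtain hr | hr := List.mem_append.1 hr
      · exact hrs r hr
      · rwa [List.mem_singleton.1 hr]
    · rw [isWeaklyRegular_append_iff, isWeaklyRegular_singleton_iff]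
      refine ⟨hw, ?_⟩
      rwa [smul_eq_mul, Ideal.mul_top]
    · rw [Ideal.ofList_append]
      exact le_sup_left
    · intro heq
      have hmem : y ∈ Ideal.ofList rs := by
        rw [heq, Ideal.ofList_append]
        exact Ideal.mem_sup_right (by simp)
      have h1 : y • (Ideal.Quotient.mk (Ideal.ofList rs) 1) = y • 0 := by
        rw [smul_zero, ← Ideal.Quotient.mk_eq_mk, ← Submodule.Quotient.mk_smul,
          Submodule.Quotient.mk_eq_zero]
        simpa using hmem
      have h2 := hyreg h1
      rw [Ideal.Quotient.eq_zero_iff_mem] at h2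
      exact hne ((Ideal.eq_top_iff_one _).2 h2)
  have hHom : ¬ Subsingleton ((R ⧸ a) →ₗ[R] R ⧸ Ideal.ofList rs) := by
    rw [IsSMulRegular.subsingleton_linearMap_iff, Ideal.annihilator_quotient]
    rintro ⟨y, hy, hyreg⟩
    exact hno y hy hyreg
  have := not_subsingleton_iff_nontrivial.1 hHom
  obtain ⟨f, hf⟩ := exists_ne (0 : (R ⧸ a) →ₗ[R] R ⧸ Ideal.ofList rs)
  have hf1 : f (Submodule.Quotient.mk 1) ≠ 0 := by
    intro h
    refine hf (LinearMap.ext fun x => ?_)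
    obtain ⟨r, rfl⟩ := Submodule.Quotient.mk_surjective _ x
    have : (Submodule.Quotient.mk r : R ⧸ a) = r • Submodule.Quotient.mk 1 := by
      rw [← Submodule.Quotient.mk_smul, smul_eq_mul, mul_one]
    rw [this, map_smul, h, smul_zero, LinearMap.zero_apply]
  obtain ⟨p, hp, hle⟩ := exists_le_isAssociatedPrime_of_isNoetherianRing R _ hf1
  obtain ⟨hp', z', hz'⟩ := isAssociatedPrime_iff.1 hp
  obtain ⟨z, rfl⟩ := Submodule.Quotient.mk_surjective _ z'
  refine ⟨p, hp', fun r hr => hle ?_, z, fun r => ?_⟩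
  · rw [Submodule.mem_colon_singleton, Submodule.mem_bot, ← map_smul, ← Submodule.Quotient.mk_smul,
      (Submodule.Quotient.mk_eq_zero a).2 (by simpa using hr), map_zero]
  · rw [hz', Submodule.mem_colon_singleton, Submodule.mem_bot, ← Submodule.Quotient.mk_smul,
      Submodule.Quotient.mk_eq_zero, smul_eq_mul]

/-- The transition maps `Ext^g(R ⧸ a, M) → Ext^g(R ⧸ a ^ m, M)` are injective when `a` contains an
`M`-regular sequence of length `g`, so a nonzero class survives in `H^g_a(M)`. -/
lemma not_extPowColimitVanishes_of_nontrivial_ext [IsNoetherianRing R] {a : Ideal R}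
    {M : Type u} [AddCommGroup M] [Module R M] [Module.Finite R M]
    (hM : a • (⊤ : Submodule R M) ≠ ⊤) {rs : List R} (hrs : ∀ r ∈ rs, r ∈ a)
    (hreg : IsRegular M rs)
    (h : Nontrivial (Abelian.Ext.{u} (ModuleCat.of R (R ⧸ a ^ 1)) (ModuleCat.of R M) rs.length)) :
    ¬ ExtPowColimitVanishes a rs.length (ModuleCat.of R M) := by
  intro hv
  obtain ⟨e, he⟩ := exists_ne
    (0 : Abelian.Ext.{u} (ModuleCat.of R (R ⧸ a ^ 1)) (ModuleCat.of R M) rs.length)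
  obtain ⟨m, hm, h0⟩ := hv 1 e
  have hsurj : Function.Surjective (powQuotientMap a hm).hom := fun x => by
    obtain ⟨r, rfl⟩ := Submodule.Quotient.mk_surjective _ x
    exact ⟨Submodule.Quotient.mk r, rfl⟩
  have hS := LinearMap.shortExact_shortComplexKer hsurj
  apply he
  generalize hg : rs.length = g at *
  cases g with
  | zero =>
    obtain ⟨f, rfl⟩ := (Abelian.Ext.mk₀_bijective _ _).2 e
    rw [Abelian.Ext.mk₀_comp_mk₀] at h0
    have h1 : powQuotientMap a hm ≫ f = 0 := by
      apply (Abelian.Ext.mk₀_bijective _ _).1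
      rw [h0, Abelian.Ext.mk₀_zero]
    have : Epi (powQuotientMap a hm) := (ModuleCat.epi_iff_surjective _).2 hsurj
    rw [(cancel_epi (powQuotientMap a hm)).1 (h1.trans comp_zero.symm), Abelian.Ext.mk₀_zero]
  | succ g =>
    -- The kernel of `R ⧸ a ^ m → R ⧸ a ^ 1` is supported on `V(a)`, so its `Ext^g` into `M`
    -- vanishes below the length `g + 1`.
    have hsupp : Module.support R (LinearMap.ker (powQuotientMap a hm).hom) ⊆
        PrimeSpectrum.zeroLocus a := by
      rw [Module.support_eq_zeroLocus, PrimeSpectrum.zeroLocus_subset_zeroLocus_iff]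
      intro r hr
      refine ⟨m, Module.mem_annihilator.2 fun x => Subtype.ext ?_⟩
      obtain ⟨s, hs⟩ := Submodule.Quotient.mk_surjective _ x.1
      rw [Submodule.coe_smul, ← hs, ← Submodule.Quotient.mk_smul]
      exact (Submodule.Quotient.mk_eq_zero _).2 (Ideal.mul_mem_right _ _ (Ideal.pow_mem_pow hr m))
    have hsub := ModuleCat.subsingleton_ext_of_exists_isRegular a
      (ModuleCat.of R (LinearMap.ker (powQuotientMap a hm).hom)) hsupp (ModuleCat.of R M)
      hM.lt_top rs hrs hreg g (by omega)
    obtain ⟨y, hy⟩ := Abelian.Ext.contravariant_sequence_exact₃ hS (ModuleCat.of R M) e h0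
      (add_comm 1 g)
    rw [← hy, hsub.elim y 0, Abelian.Ext.comp_zero]

end Grade

/-! ### The depth inequality for modules of finite projective dimension. -/

section AuslanderBuchsbaum

open CategoryTheory Limits IsLocalRing Module
open scoped TensorProduct

variable {A : Type u} [CommRing A]

/-- The annihilator of `L` kills `e`, and pushing `e` along `1 ↦ r • y` is `r` times pushing it
along `1 ↦ y`. -/
lemma ext_comp_eq_zero_of_mem_smul_top {I : Ideal A} {L : ModuleCat.{u} A}
    (hL : I ≤ Module.annihilator A L) {F : Type u} [AddCommGroup F] [Module A F] {n : ℕ}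
    (e : Abelian.Ext.{u} L (ModuleCat.of A A) n) {w : F} (hw : w ∈ I • (⊤ : Submodule A F)) :
    e.comp (Abelian.Ext.mk₀ (ModuleCat.ofHom (LinearMap.toSpanSingleton A F w))) (add_zero n) =
      0 := by
  have hann {r : A} (hr : r ∈ I) : r • e = 0 := by
    have h0 : r • 𝟙 L = 0 := by
      refine ModuleCat.hom_ext (LinearMap.ext fun x => ?_)
      exact Module.mem_annihilator.1 (hL hr) x
    have h1 : r • e = (Abelian.Ext.mk₀ (r • 𝟙 L)).comp e (zero_add n) := by
      simp [Abelian.Ext.mk₀_smul]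
    rw [h1, h0, Abelian.Ext.mk₀_zero, Abelian.Ext.zero_comp]
  induction hw using Submodule.smul_induction_on' with
  | smul r hr y _ =>
    have : ModuleCat.ofHom (LinearMap.toSpanSingleton A F (r • y)) =
        r • ModuleCat.ofHom (LinearMap.toSpanSingleton A F y) := by
      refine ModuleCat.hom_ext (LinearMap.ext fun x => ?_)
      exact smul_comm x r y
    rw [this, Abelian.Ext.mk₀_smul, Abelian.Ext.comp_smul, ← Abelian.Ext.smul_comp, hann hr,
      Abelian.Ext.zero_comp]
  | add y _ z _ hy hz =>
    have : ModuleCat.ofHom (LinearMap.toSpanSingleton A F (y + z)) =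
        ModuleCat.ofHom (LinearMap.toSpanSingleton A F y) +
          ModuleCat.ofHom (LinearMap.toSpanSingleton A F z) := by
      refine ModuleCat.hom_ext (LinearMap.ext fun x => ?_)
      exact smul_add x y z
    rw [this, Abelian.Ext.mk₀_add, Abelian.Ext.comp_add, hy, hz, add_zero]

/-- A basis writes the identity of `F` as a finite sum of maps factoring through `A`. -/
lemma subsingleton_ext_of_free {L : ModuleCat.{u} A} {n : ℕ}
    (h : Subsingleton (Abelian.Ext.{u} L (ModuleCat.of A A) n))
    (F : Type u) [AddCommGroup F] [Module A F] [Module.Free A F] [Module.Finite A F] :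
    Subsingleton (Abelian.Ext.{u} L (ModuleCat.of A F) n) := by
  refine subsingleton_of_forall_eq 0 fun e => ?_
  let b := Module.Free.chooseBasis A F
  let Φ : (ModuleCat.of A F ⟶ ModuleCat.of A F) →+ Abelian.Ext.{u} L (ModuleCat.of A F) n :=
    AddMonoidHom.mk' (fun g => e.comp (Abelian.Ext.mk₀ g) (add_zero n)) fun g g' => by
      simp [Abelian.Ext.mk₀_add]
  have hid : 𝟙 (ModuleCat.of A F) = ∑ i, ModuleCat.ofHom (b.coord i) ≫
      ModuleCat.ofHom (LinearMap.toSpanSingleton A F (b i)) := by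
    refine ModuleCat.hom_ext (LinearMap.ext fun x => ?_)
    rw [ModuleCat.hom_sum, LinearMap.sum_apply]
    exact (b.sum_repr x).symm
  have h1 : Φ (𝟙 _) = e := e.comp_mk₀_id
  rw [← h1, hid, map_sum]
  refine Finset.sum_eq_zero fun i _ => ?_
  change e.comp (Abelian.Ext.mk₀ _) (add_zero n) = 0
  rw [← Abelian.Ext.mk₀_comp_mk₀, ← Abelian.Ext.comp_assoc_of_third_deg_zero,
    h.elim (e.comp _ _) 0, Abelian.Ext.zero_comp]

variable [IsLocalRing A]

lemma exists_linearMap_eq_one_of_notMem_smul_top {K : Type*} [AddCommGroup K] [Module A K]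
    [Module.Free A K] {v : K} (hv : v ∉ maximalIdeal A • (⊤ : Submodule A K)) :
    ∃ φ : K →ₗ[A] A, φ v = 1 := by
  let b := Module.Free.chooseBasis A K
  obtain ⟨i, hi⟩ : ∃ i, b.repr v i ∉ maximalIdeal A := by
    by_contra! h
    refine hv ?_
    rw [← b.linearCombination_repr v, Finsupp.linearCombination_apply]
    exact Submodule.sum_mem _ fun i _ => Submodule.smul_mem_smul (h i) trivial
  rw [mem_maximalIdeal, mem_nonunits_iff, not_not] at hi
  obtain ⟨c, hc⟩ := hi.exists_left_inv
  exact ⟨c • b.coord i, hc⟩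

/-- If a free module `K` maps to `F` so that the map on `Ext^t(L, -)` is injective, for some `L`
killed by the maximal ideal with `Ext^t(L, A) ≠ 0`, then `K → F` is injective modulo the maximal
ideal. -/
lemma lTensor_residueField_injective_of_ext {L : ModuleCat.{u} A}
    (hL : maximalIdeal A ≤ Module.annihilator A L) {t : ℕ}
    (ht : Nontrivial (Abelian.Ext.{u} L (ModuleCat.of A A) t))
    {K F : Type u} [AddCommGroup K] [Module A K] [AddCommGroup F] [Module A F] [Module.Free A K]
    (f : K →ₗ[A] F)
    (hf : ∀ e : Abelian.Ext.{u} L (ModuleCat.of A K) t,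
      e.comp (Abelian.Ext.mk₀ (ModuleCat.ofHom f)) (add_zero t) = 0 → e = 0) :
    Function.Injective (f.lTensor (ResidueField A)) := by
  have hmk (N : Type u) [AddCommGroup N] [Module A N] (y : N) :
      (1 : ResidueField A) ⊗ₜ[A] y = 0 ↔ y ∈ maximalIdeal A • (⊤ : Submodule A N) := by
    have h1 : TensorProduct.quotTensorEquivQuotSMul N (maximalIdeal A)
        ((Ideal.Quotient.mk (maximalIdeal A) 1) ⊗ₜ[A] y) = Submodule.Quotient.mk y := by
      rw [TensorProduct.quotTensorEquivQuotSMul_mk_tmul, one_smul]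
    rw [← Submodule.Quotient.mk_eq_zero, ← h1, LinearEquiv.map_eq_zero_iff]
    rfl
  rw [injective_iff_map_eq_zero]
  intro x hx
  obtain ⟨v, rfl⟩ := TensorProduct.mk_surjective A K (ResidueField A) residue_surjective x
  rw [TensorProduct.mk_apply] at hx ⊢
  rw [LinearMap.lTensor_tmul, hmk] at hx
  rw [hmk]
  by_contra hv
  -- Now `v` spans a direct summand `A` of `K`, so pushing `e` into `K` along `v` loses nothing, yet
  -- the result dies in `F`.
  obtain ⟨φ, hφ⟩ := exists_linearMap_eq_one_of_notMem_smul_top hv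
  obtain ⟨e, he⟩ := exists_ne (0 : Abelian.Ext.{u} L (ModuleCat.of A A) t)
  let s := ModuleCat.ofHom (LinearMap.toSpanSingleton A K v)
  have h1 : e.comp (Abelian.Ext.mk₀ s) (add_zero t) = 0 := by
    apply hf
    rw [Abelian.Ext.comp_assoc_of_third_deg_zero, Abelian.Ext.mk₀_comp_mk₀]
    have : s ≫ ModuleCat.ofHom f = ModuleCat.ofHom (LinearMap.toSpanSingleton A F (f v)) := by
      refine ModuleCat.hom_ext (LinearMap.ext fun x => ?_)
      exact map_smul f x v
    rw [this]
    exact ext_comp_eq_zero_of_mem_smul_top hL e hx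
  have h2 : s ≫ ModuleCat.ofHom φ = 𝟙 _ := by
    refine ModuleCat.hom_ext (LinearMap.ext fun x => ?_)
    refine (map_smul φ x v).trans ?_
    rw [hφ, smul_eq_mul, mul_one]
    rfl
  apply he
  rw [← e.comp_mk₀_id, ← h2, ← Abelian.Ext.mk₀_comp_mk₀,
    ← Abelian.Ext.comp_assoc_of_third_deg_zero, h1, Abelian.Ext.zero_comp]

variable [IsNoetherianRing A]

/-- A finite module of finite projective dimension whose depth is at least the depth of the
local ring is free. -/
lemma free_of_hasProjectiveDimensionLT {L : ModuleCat.{u} A}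
    (hL : maximalIdeal A ≤ Module.annihilator A L) {t : ℕ}
    (hlt : ∀ i < t, Subsingleton (Abelian.Ext.{u} L (ModuleCat.of A A) i))
    (ht : Nontrivial (Abelian.Ext.{u} L (ModuleCat.of A A) t)) (s : ℕ)
    (N : Type u) [AddCommGroup N] [Module A N] [Module.Finite A N]
    (hN : HasProjectiveDimensionLT (ModuleCat.of A N) (s + 1))
    (hNlt : ∀ i < t, Subsingleton (Abelian.Ext.{u} L (ModuleCat.of A N) i)) :
    Module.Free A N := by
  induction s generalizing N with
  | zero =>
    rw [zero_add, ← projective_iff_hasProjectiveDimensionLT_one, ← IsProjective.iff_projective]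
      at hN
    exact Module.free_of_flat_of_isLocalRing
  | succ s ih =>
    obtain ⟨P, _, _, _, _, f, hf⟩ := Module.exists_finite_presentation A N
    have hS := LinearMap.shortExact_shortComplexKer hf
    have hproj : Projective f.shortComplexKer.X₂ :=
      ModuleCat.projective_of_categoryTheory_projective _
    have hmono : Mono f.shortComplexKer.f := hS.mono_f
    -- The kernel of `Ext^i(L, K) → Ext^i(L, P)` comes from `Ext^(i-1)(L, N) = 0`. For `i < t` this
    -- makes the syzygy `K` satisfy the induction hypotheses; for `i = t` it makes `K → P` injective
    -- modulo the maximal ideal.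
    have hinj : ∀ i ≤ t, ∀ e : Abelian.Ext.{u} L f.shortComplexKer.X₁ i,
        e.comp (Abelian.Ext.mk₀ f.shortComplexKer.f) (add_zero i) = 0 → e = 0 := by
      intro i hi e he
      cases i with
      | zero =>
        apply Abelian.Ext.postcomp_mk₀_injective_of_mono L f.shortComplexKer.f
        rw [map_zero]
        exact he
      | succ i =>
        obtain ⟨y, hy⟩ := Abelian.Ext.covariant_sequence_exact₁ L hS e he rfl
        have := hNlt i (by omega)
        rw [← hy, Subsingleton.elim y 0, Abelian.Ext.zero_comp]
    have hK : Module.Free A (LinearMap.ker f) := by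
      refine ih (LinearMap.ker f) ((hS.hasProjectiveDimensionLT_X₃_iff s hproj).1 hN) fun i hi => ?_
      refine subsingleton_of_forall_eq 0 fun e => hinj i hi.le e ?_
      have := subsingleton_ext_of_free (hlt i hi) P
      exact Subsingleton.elim _ _
    exact Module.free_of_lTensor_residueField_injective (LinearMap.ker f).subtype f hf
      (LinearMap.exact_subtype_ker_map f)
      (lTensor_residueField_injective_of_ext hL ht _ (hinj t le_rfl))

/-- Depth of a nonzero finite module of finite projective dimension is at most the depth of the
ring. -/
lemma subsingleton_of_hasProjectiveDimensionLT {L : ModuleCat.{u} A}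
    (hL : maximalIdeal A ≤ Module.annihilator A L) {t : ℕ}
    (hlt : ∀ i < t, Subsingleton (Abelian.Ext.{u} L (ModuleCat.of A A) i))
    (ht : Nontrivial (Abelian.Ext.{u} L (ModuleCat.of A A) t)) (s : ℕ)
    (N : Type u) [AddCommGroup N] [Module A N] [Module.Finite A N]
    (hN : HasProjectiveDimensionLT (ModuleCat.of A N) (s + 1))
    (hNle : ∀ i ≤ t, Subsingleton (Abelian.Ext.{u} L (ModuleCat.of A N) i)) :
    Subsingleton N := by
  have := free_of_hasProjectiveDimensionLT hL hlt ht s N hN fun i hi => hNle i hi.le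
  by_contra hne
  rw [not_subsingleton_iff_nontrivial] at hne
  -- Since `Ext^t(L, N) = 0`, even the zero map qualifies; hence `N` vanishes modulo the maximal
  -- ideal and Nakayama applies.
  have hinj := lTensor_residueField_injective_of_ext hL ht (0 : N →ₗ[A] N)
    fun e _ => (hNle t le_rfl).elim e 0
  have h1 : Subsingleton (TensorProduct A (ResidueField A) N) :=
    ⟨fun x y => hinj (by rw [LinearMap.lTensor_zero, LinearMap.zero_apply, LinearMap.zero_apply])⟩
  exact not_subsingleton _ (IsLocalRing.subsingleton_tensorProduct.1 h1)

end AuslanderBuchsbaum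

/-! ### Bounding the grade by localizing at an associated prime. -/

section LocalizationDepth

open CategoryTheory IsLocalRing RingTheory.Sequence

variable {R : Type u} [CommRing R]

lemma hasProjectiveDimensionLE_localizedModule (S : Submonoid R) {M : Type u} [AddCommGroup M]
    [Module R M] (n : ℕ) [HasProjectiveDimensionLE (ModuleCat.of R M) n] :
    HasProjectiveDimensionLE (ModuleCat.of (Localization S) (LocalizedModule S M)) n := by
  have := ModuleCat.localizedModule_hasProjectiveDimensionLE n S (ModuleCat.of R M)
  exact ModuleCat.hasProjectiveDimensionLE_of_linearEquiv.{u, u}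
    (M := (ModuleCat.of R M).localizedModule S)
    (N := ModuleCat.of (Localization S) (LocalizedModule S M))
    (Shrink.linearEquiv (Localization S) (LocalizedModule S M)) n

/-- If `p` is associated to `R ⧸ (rs)` for an `R`-regular sequence `rs` in `p`, then a faithful
finite module of finite projective dimension has no regular sequence in `p` longer than `rs`. -/
lemma length_le_of_isWeaklyRegular [IsNoetherianRing R] {p : Ideal R} [p.IsPrime] {rs : List R}
    (hrs : ∀ r ∈ rs, r ∈ p) (hreg : IsWeaklyRegular R rs) {z : R}
    (hz : ∀ r, r ∈ p ↔ r * z ∈ Ideal.ofList rs) {M : Type u} [AddCommGroup M] [Module R M]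
    [Module.Finite R M] [FaithfulSMul R M] (n : ℕ)
    [HasProjectiveDimensionLE (ModuleCat.of R M) n] {xs : List R}
    (hxs : ∀ x ∈ xs, x ∈ p) (hxreg : IsWeaklyRegular M xs) : xs.length ≤ rs.length := by
  by_contra! hlt
  let A := Localization.AtPrime p
  let N := LocalizedModule p.primeCompl M
  let L := ModuleCat.of A (A ⧸ maximalIdeal A)
  have hN : Nontrivial N := by
    have : (⟨p, ‹_›⟩ : PrimeSpectrum R) ∈ Module.support R M := by
      rw [Module.mem_support_iff_of_finite, Module.annihilator_eq_bot.2 inferInstance]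
      exact bot_le
    exact Module.mem_support_iff.1 this
  have hann : Module.annihilator A L = maximalIdeal A := Ideal.annihilator_quotient
  have hsupp : Module.support A L ⊆ PrimeSpectrum.zeroLocus (maximalIdeal A) := by
    rw [Module.support_eq_zeroLocus, hann]
  have htop (K : Type u) [AddCommGroup K] [Module A K] [Module.Finite A K] [Nontrivial K] :
      maximalIdeal A • (⊤ : Submodule A K) ≠ ⊤ :=
    (Submodule.top_ne_ideal_smul_of_le_jacobson_annihilator
      (IsLocalRing.maximalIdeal_le_jacobson _)).symm
  have hmem {ys : List R} (hys : ∀ y ∈ ys, y ∈ p) :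
      ∀ y ∈ ys.map (algebraMap R A), y ∈ maximalIdeal A := by
    intro y hy
    obtain ⟨r, hr, rfl⟩ := List.mem_map.1 hy
    exact (IsLocalization.AtPrime.to_map_mem_maximal_iff A p r).2 (hys r hr)
  have hregA : IsRegular A (rs.map (algebraMap R A)) :=
    hreg.isRegular_of_isLocalization_of_mem A p hrs
  have hregN : IsRegular N (xs.map (algebraMap R A)) :=
    hxreg.isRegular_of_isLocalizedModule_of_mem A p (LocalizedModule.mkLinearMap p.primeCompl M) hxs
  have hHom : Nontrivial (L →ₗ[A] A ⧸ Ideal.ofList (rs.map (algebraMap R A)) •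
      (⊤ : Submodule A A)) := by
    have hI : Ideal.ofList (rs.map (algebraMap R A)) • (⊤ : Submodule A A) =
        (Ideal.ofList rs).map (algebraMap R A) := by
      rw [smul_eq_mul, Ideal.mul_top, Ideal.map_ofList]
    rw [hI]
    -- The class of `z` stays nonzero in the localization, since its annihilator is `p`, and it is
    -- killed by the maximal ideal.
    let y : A ⧸ (Ideal.ofList rs).map (algebraMap R A) := Submodule.Quotient.mk (algebraMap R A z)
    have hy : y ≠ 0 := by
      rw [Ne, Submodule.Quotient.mk_eq_zero,
        IsLocalization.algebraMap_mem_map_algebraMap_iff p.primeCompl]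
      rintro ⟨s, hs, hsz⟩
      exact hs ((hz s).2 hsz)
    have hker : maximalIdeal A ≤ LinearMap.ker (LinearMap.toSpanSingleton A _ y) := by
      rw [← Localization.AtPrime.map_eq_maximalIdeal, Ideal.map_le_iff_le_comap]
      intro r hr
      rw [Ideal.mem_comap, LinearMap.mem_ker, LinearMap.toSpanSingleton_apply,
        ← Submodule.Quotient.mk_smul, Submodule.Quotient.mk_eq_zero, smul_eq_mul, ← map_mul]
      exact Ideal.mem_map_of_mem _ ((hz r).1 hr)
    refine ⟨Submodule.liftQ _ (LinearMap.toSpanSingleton A _ y) hker, 0, fun h => hy ?_⟩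
    have := LinearMap.congr_fun h (Submodule.Quotient.mk 1)
    rwa [Submodule.liftQ_apply, LinearMap.toSpanSingleton_apply, one_smul] at this
  have hlt' := ModuleCat.subsingleton_ext_of_exists_isRegular (maximalIdeal A) L hsupp
    (ModuleCat.of A A) (htop A).lt_top _ (hmem hrs) hregA
  have ht := nontrivial_ext_of_isRegular hsupp _ A (htop A) (hmem hrs) hregA hHom
  have hNle := ModuleCat.subsingleton_ext_of_exists_isRegular (maximalIdeal A) L hsupp
    (ModuleCat.of A N) (htop N).lt_top _ (hmem hxs) hregN
  have hpd := hasProjectiveDimensionLE_localizedModule p.primeCompl (M := M) n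
  exact not_subsingleton N (subsingleton_of_hasProjectiveDimensionLT hann.ge hlt' ht n N hpd
    fun i hi => hNle i (by simp only [List.length_map] at hi ⊢; omega))

end LocalizationDepth

/-! ### Transfer of vanishing from a faithful module, and the theorem. -/

section CohomologicalDimension

open CategoryTheory

variable {R : Type u} [CommRing R] {a : Ideal R}

/-- Local cohomology of finite modules vanishes in the degrees above `t` if that of one faithful
finite module does. -/
lemma ExtPowColimitVanishes.of_faithful [IsNoetherianRing R] {M : Type u} [AddCommGroup M]
    [Module R M] [Module.Finite R M] [FaithfulSMul R M] {t : ℕ}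
    (hM : ∀ i, t < i → ExtPowColimitVanishes a i (ModuleCat.of R M)) {i : ℕ} (hi : t < i)
    (N : Type u) [AddCommGroup N] [Module R N] [Module.Finite R N] :
    ExtPowColimitVanishes a i (ModuleCat.of R N) := by
  obtain ⟨s, rfl⟩ := (isNoetherian_def.1 ‹IsNoetherianRing R›) a
  -- Descending induction on the degree: `k = 0` covers degrees above the number of generators, and
  -- each increment of `k` admits one lower degree.
  have key (k : ℕ) : ∀ i, t < i → s.toList.length < i + k → ∀ (N : Type u) [AddCommGroup N]
      [Module R N] [Module.Finite R N],
      ExtPowColimitVanishes (Ideal.span (s : Set R)) i (ModuleCat.of R N) := by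
    induction k with
    | zero =>
      intro i _ hs N _ _ _
      have : Ideal.span (s : Set R) = Ideal.ofList s.toList := by
        rw [Ideal.ofList]
        congr 1
        ext x
        simp
      rw [this]
      exact extPowColimitVanishes_of_length_lt _ _ hs
    | succ k ih =>
      intro i hi hs N _ _ _
      exact of_quotient (quotient_of_faithful (hM i hi)
        fun N _ _ _ => ih (i + 1) (by omega) (by omega) N) N
  exact key (s.toList.length) i hi (by omega) N

/-- By Nakayama, `aM = M` gives an element of `1 + a` killing `M`; by faithfulness it is zero, so `1
∈ a`. -/
lemma smul_top_ne_top_of_faithfulSMul (ha : a ≠ ⊤) (M : Type u) [AddCommGroup M] [Module R M]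
    [Module.Finite R M] [FaithfulSMul R M] : a • (⊤ : Submodule R M) ≠ ⊤ := by
  intro h
  obtain ⟨r, hr, hr0⟩ := Submodule.exists_sub_one_mem_and_smul_eq_zero_of_fg_of_le_smul a ⊤
    Module.Finite.fg_top h.ge
  have : r = 0 := FaithfulSMul.eq_of_smul_eq_smul (α := M) fun m => by
    rw [hr0 m trivial, zero_smul]
  rw [this, zero_sub] at hr
  exact ha ((Ideal.eq_top_iff_one a).2 (by simpa using hr))

end CohomologicalDimension

theorem proposition2 {R : Type u} [CommRing R] [IsNoetherianRing R]
    (a : Ideal R) (ha : a ≠ ⊤)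
    (M : Type u) [AddCommGroup M] [Module R M] [FaithfulSMul R M]
    (hM : RelativeCM.IsRelativeCohenMacaulay a M)
    (hpd : CategoryTheory.projectiveDimension (ModuleCat.of R M) < ⊤) :
    RelativeCM.IsRelativeCohenMacaulay a R := by
  obtain ⟨hfin, hM⟩ := hM
  have haM := smul_top_ne_top_of_faithfulSMul ha M
  have haR : a • (⊤ : Submodule R R) ≠ ⊤ := by rwa [smul_eq_mul, Ideal.mul_top]
  have hcd := (hM.resolve_left haM).2
  obtain ⟨n, hn⟩ : ∃ n : ℕ, CategoryTheory.HasProjectiveDimensionLE (ModuleCat.of R M) n := by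
    obtain ⟨n, hn⟩ : ∃ n : ℕ, CategoryTheory.projectiveDimension (ModuleCat.of R M) ≤ n := by
      generalize CategoryTheory.projectiveDimension (ModuleCat.of R M) = d at hpd
      induction d with
      | bot => exact ⟨0, bot_le⟩
      | coe d =>
        induction d with
        | top => exact absurd hpd (lt_irrefl _)
        | coe d => exact ⟨d, le_rfl⟩
    exact ⟨n, (CategoryTheory.projectiveDimension_le_iff _ n).1 hn⟩
  obtain ⟨rs, hrs, hreg, p, hp, hap, z, hz⟩ := exists_maximal_isRegular ha
  have hgM : RelativeCM.idealGrade a M ≤ rs.length := by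
    rw [RelativeCM.idealGrade, if_neg haM]
    refine iSup₂_le fun xs hxs => ?_
    exact_mod_cast length_le_of_isWeaklyRegular (fun r hr => hap (hrs r hr)) hreg.1 hz n
      (fun x hx => hap (hxs.1 x hx)) hxs.2.1
  have hext : Nontrivial (CategoryTheory.Abelian.Ext.{u} (ModuleCat.of R (R ⧸ a ^ 1))
      (ModuleCat.of R R) rs.length) := by
    rw [pow_one]
    refine nontrivial_ext_of_isRegular (I := a) ?_ rs R haR hrs hreg ?_
    · rw [Module.support_eq_zeroLocus]
      exact (congrArg (fun I : Ideal R => PrimeSpectrum.zeroLocus (I : Set R))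
        Ideal.annihilator_quotient).subset
    · rw [smul_eq_mul, Ideal.mul_top]
      -- The map `1 ↦ z` is defined on `R ⧸ a` because `a ≤ p`, and nonzero because `1 ∉ p`.
      refine ⟨Submodule.liftQ _ (LinearMap.toSpanSingleton R _ (Submodule.Quotient.mk z))
        fun r hr => ?_, 0, fun h => ?_⟩
      · rw [LinearMap.mem_ker, LinearMap.toSpanSingleton_apply, ← Submodule.Quotient.mk_smul,
          Submodule.Quotient.mk_eq_zero, smul_eq_mul]
        exact (hz r).1 (hap hr)
      · have := LinearMap.congr_fun h (Submodule.Quotient.mk 1)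
        rw [Submodule.liftQ_apply, LinearMap.toSpanSingleton_apply, one_smul,
          LinearMap.zero_apply, Submodule.Quotient.mk_eq_zero] at this
        exact hp.ne_top ((Ideal.eq_top_iff_one p).2 ((hz 1).2 (by rwa [one_mul])))
  have hgR : RelativeCM.idealGrade a R = rs.length := by
    rw [RelativeCM.idealGrade, if_neg haR]
    refine le_antisymm (iSup₂_le fun xs hxs => ?_) (le_iSup₂_of_le rs ⟨hrs, hreg⟩ le_rfl)
    by_contra! hlt
    have hlt' : rs.length < xs.length := by exact_mod_cast hlt
    rw [pow_one] at hext
    refine not_subsingleton_iff_nontrivial.2 hext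
      (ModuleCat.subsingleton_ext_of_exists_isRegular a _ ?_ (ModuleCat.of R R)
        haR.lt_top xs hxs.1 hxs.2 _ hlt')
    rw [Module.support_eq_zeroLocus]
    exact (congrArg (fun I : Ideal R => PrimeSpectrum.zeroLocus (I : Set R))
      Ideal.annihilator_quotient).subset
  have hvM (i : ℕ) (hi : rs.length < i) : ExtPowColimitVanishes a i (ModuleCat.of R M) := by
    rw [← subsingleton_localCohomology_iff, ← not_nontrivial_iff_subsingleton]
    intro hnt
    have h1 : ((i : ℕ∞) : WithBot ℕ∞) ≤ RelativeCM.cohomDim a M := le_sSup ⟨i, hnt, rfl⟩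
    rw [← hcd, WithBot.coe_le_coe] at h1
    exact absurd (h1.trans hgM) (by exact_mod_cast hi.not_ge)
  refine ⟨inferInstance, Or.inr ⟨haR, ?_⟩⟩
  rw [hgR]
  refine le_antisymm (le_sSup ⟨rs.length, ?_, rfl⟩) (sSup_le ?_)
  · rw [← not_subsingleton_iff_nontrivial, subsingleton_localCohomology_iff]
    exact not_extPowColimitVanishes_of_nontrivial_ext haR hrs hreg hext
  · rintro d ⟨i, hnt, rfl⟩
    by_contra! hlt
    have hi : rs.length < i := by exact_mod_cast hlt
    exact not_subsingleton_iff_nontrivial.2 hnt ((subsingleton_localCohomology_iff a i _).2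
      (ExtPowColimitVanishes.of_faithful hvM hi R))
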